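/- **Setting.** Let $V$ be a finite-dimensional real vector space with a finite increasing filtration $W$, non-degenerate bilinear forms $\langle\,,\rangle_w$ on $Gr^W_w=W_w/W_{w-1}$, symmetric for $w$ even and antisymmetric for $w$ odd, and Hodge numbers $h^{p,q}=h^{q,p}\ge 0$ with $\dim Gr^W_w=\sum_{p+q=w}h^{p,q}$. Let $\mathcal M$ be the classifying space of all finite decreasing filtrations $F$ of $V_{\mathbb C}$ such that $(F,W)$ is a mixed Hodge structure for which each $F(Gr^W_w)$ is a Hodge structure of weight $w$ polarized by $\langle\,,\rangle_w$ with Hodge numbers $h^{p,q}$. For $A=\mathbb R,\mathbb C$ let $G_A$ be the group of $A$-linear automorphisms of $V_A$ that preserve $W$ and act on each $Gr^W_{w,A}$ by isometries of $\langle\,,\rangle_w$, and let $\mathfrak g_{\mathbb C}=\mathrm{Lie}(G_{\mathbb C})$. **Metrics.** Let $F\in\mathcal M$, let $V_{\mathbb C}=\bigoplus I^{p,q}$ be the Deligne bigrading of $(F,W)$, with induced bigrading $\mathfrak g_{\mathbb C}=\bigoplus\mathfrak g^{p,q}$. The mixed Hodge metric $h_F$ on $V_{\mathbb C}$ makes the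 $I^{p,q}$ mutually orthogonal and satisfies $h_F(u,v)=i^{p-q}\langle gr(u),gr(\bar v)\rangle_{p+q}$ for $u,v\in I^{p,q}$; it induces $\|\alpha\|_F^2=\mathrm{Tr}(\alpha\alpha^*)$ on $\mathrm{End}(V_{\mathbb C})$. The tangent space $T_F(\mathcal M)=\mathfrak g_{\mathbb C}/\mathfrak g_{\mathbb C}^F$, where $\mathfrak g_{\mathbb C}^F$ is the stabilizer of $F$, is identified with $q_F=\bigoplus_{p<0,\,p+q\le 0}\mathfrak g^{p,q}$, and $L_{g*}$ is the differential of $F\mapsto g.F$. **Twisting function.** Let $\Lambda^{-1,-1}$ be the space of $X\in\mathrm{End}(V_{\mathbb C})$ with $X(I^{p,q})\subseteq\bigoplus_{a<p,\,b<q}I^{a,b}$ for all $p,q$. Let $\delta$ be the unique real element of $\Lambda^{-1,-1}$ for which $(e^{-i\delta}.F,W)$ is split over $\mathbb R$. Let $\zeta,\eta\in\Lambda^{-1,-1}$ be the unique pair of real elements with $$e^{i\delta}=e^{\zeta}\Big(1+\sum_{k\ge1}P_k\Big),\qquad P_0=1,\quad P_k=-\frac1k\sum_{j=1}^kP_{k-j}C_{j+1},\qquad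 C_{j+1}=i\sum_{p,q\ge1}b^{\,j-1}_{p-1,q-1}\,\eta^{-p,-q},$$ where $(1-x)^p(1+x)^q=\sum_k b^k_{p,q}x^k$ and $\eta^{-p,-q}$ are the Hodge components of $\eta$ with respect to $(e^{-i\delta}.F,W)$. Let $\epsilon=\epsilon(F,W)\in\Lambda^{-1,-1}$ be defined by $e^{\epsilon}=e^{i\delta}e^{-\zeta}$ (so that $(e^{-\epsilon}.F,W)$ is the canonical $\mathbb R$-split mixed Hodge structure attached to $(F,W)$ by the $SL_2$-orbit theorem), let $\epsilon=\sum_{p,q<0}\epsilon^{p,q}$ be its decomposition into Hodge components with respect to $(F,W)$, and put $$\tau(F)=1+\sum_{p,q<0}\|\epsilon^{p,q}\|_F^{-2/(p+q)} .$$ **Twisted metric.** The twisted metric on $V_{\mathbb C}$ at $F$ is obtained from the mixed Hodge metric by scaling the norm on $I^{p,q}$ by $\tau(F)^{(p+q)/2}$. The twisted metric $h_\tau$ on $T_F(\mathcal M)\cong q_F$ is $h_\tau(\alpha,\beta)=\mathrm{Tr}(\alpha\beta^*)$, the adjoint being taken with respect to the twisted metric on $V_{\mathbb C}$. **Statement.**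 The twisted metric $h_\tau$ on $\mathcal M$ is $G_{\mathbb R}$-invariant: for any $g\in G_{\mathbb R}$ and $F\in\mathcal M$ one has $g.F\in\mathcal M$, and $$L_{g*}:T_F(\mathcal M)\to T_{g.F}(\mathcal M)$$ is a (bijective, $\mathbb C$-linear) isometry for $h_\tau$. -/

import Mathlib

open scoped TensorProduct

noncomputable section

namespace MixedHodge

/-! ### Complexification and complex conjugation -/

/-- The complexification `V_ℂ = ℂ ⊗ V` of a real vector space. -/
abbrev Cx (V : Type*) [AddCommGroup V] [Module ℝ V] : Type _ := ℂ ⊗[ℝ] V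

section Basic

variable {V : Type*} [AddCommGroup V] [Module ℝ V]

/-- Complex conjugation on `V_ℂ`, as a conjugate-linear map: `z ⊗ v ↦ z̄ ⊗ v`. -/
def conj : Cx V →ₛₗ[starRingEnd ℂ] Cx V where
  toFun := TensorProduct.map Complex.conjAe.toLinearMap (LinearMap.id : V →ₗ[ℝ] V)
  map_add' := map_add _
  map_smul' c x := by
    induction x using TensorProduct.induction_on with
    | zero => simp
    | tmul z v => simp [TensorProduct.smul_tmul']
    | add x y hx hy => simp only [smul_add, map_add, hx, hy]

theorem conj_tmul (z : ℂ) (v : V) : conj (z ⊗ₜ[ℝ] v) = (starRingEnd ℂ z) ⊗ₜ[ℝ] v := rfl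

theorem conj_conj (x : Cx V) : conj (conj x) = x := by
  induction x using TensorProduct.induction_on with
  | zero => simp
  | tmul z v => simp [conj_tmul]
  | add x y hx hy => simp only [map_add, hx, hy]

/-- The complex conjugate of a complex subspace of `V_ℂ` (conjugation is an involution, so its
image and its preimage agree). -/
def conjSub (S : Submodule ℂ (Cx V)) : Submodule ℂ (Cx V) := S.comap conj

/-- The graded quotient `Gr_w = W_w / W_{w-1}`. -/
abbrev Gr (W : ℤ → Submodule ℝ V) (w : ℤ) : Type _ :=
  ↥(W w) ⧸ (W (w - 1)).submoduleOf (W w)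

/-- The quotient map `W_w → Gr_w`, extended linearly (in an arbitrary way) to all of `V`; it is
only ever applied to elements of `W_w`, see `grMap_apply`. -/
def grMap (W : ℤ → Submodule ℝ V) (w : ℤ) : V →ₗ[ℝ] Gr W w :=
  ((W (w - 1)).submoduleOf (W w)).mkQ ∘ₗ (W w).subtype.leftInverse

theorem grMap_apply (W : ℤ → Submodule ℝ V) (w : ℤ) (v : V) (hv : v ∈ W w) :
    grMap W w v = Submodule.Quotient.mk ⟨v, hv⟩ := by
  have h := LinearMap.leftInverse_apply_of_inj (W w).ker_subtype ⟨v, hv⟩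
  simp only [Submodule.subtype_apply] at h
  simp [grMap, h]

/-- The complexification of `W_w`. -/
def WC (W : ℤ → Submodule ℝ V) (w : ℤ) : Submodule ℂ (Cx V) := (W w).baseChange ℂ

/-- The complexified quotient map `W_{w,ℂ} → Gr_{w,ℂ}` (only ever applied to elements of
`W_{w,ℂ}`). -/
def grC (W : ℤ → Submodule ℝ V) (w : ℤ) : Cx V →ₗ[ℂ] Cx (Gr W w) := (grMap W w).baseChange ℂ

/-- The filtration `F(Gr_w)` induced on `Gr_{w,ℂ}` by a filtration `F` of `V_ℂ`. -/
def inducedFiltration (W : ℤ → Submodule ℝ V) (F : ℤ → Submodule ℂ (Cx V)) (w : ℤ) :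
    ℤ → Submodule ℂ (Cx (Gr W w)) :=
  fun p ↦ (F p ⊓ WC W w).map (grC W w)

/-- `Φ` is a pure Hodge structure of weight `w` on `E`, polarized by `Q`, with Hodge numbers
`h p q` (`p + q = w`).  In the last condition the number `i^{p-q} Q(u, ū)` is automatically real,
since `Q` is `(-1)^w`-symmetric. -/
structure IsPolarizedHodgeStructure {E : Type*} [AddCommGroup E] [Module ℝ E] (w : ℤ)
    (Q : LinearMap.BilinForm ℝ E) (h : ℤ → ℤ → ℕ) (Φ : ℤ → Submodule ℂ (Cx E)) : Prop where
  opposed : ∀ p, IsCompl (Φ p) (conjSub (Φ (w + 1 - p)))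
  hodgeNumber : ∀ p q, p + q = w →
    Module.finrank ℂ ↥(Φ p ⊓ conjSub (Φ q)) = h p q
  isotropic : ∀ p q, w < p + q → ∀ u ∈ Φ p, ∀ v ∈ Φ q, Q.baseChange ℂ u v = 0
  positive : ∀ p q, p + q = w → ∀ u ∈ Φ p ⊓ conjSub (Φ q), u ≠ 0 →
    0 < (Complex.I ^ (p - q) * Q.baseChange ℂ u (conj u)).re

end Basic

/-! ### The classifying space -/

/-- The data that determine a classifying space of graded-polarized mixed Hodge structures on `V`:
a finite increasing filtration `W`, non-degenerate `(-1)^w`-symmetric forms on the graded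
quotients `Gr_w`, and Hodge numbers.  As `h^{p,q}_w` vanishes unless `w = p + q`, the Hodge
numbers are indexed by `(p, q)` alone. -/
structure ClassifyingData (V : Type*) [AddCommGroup V] [Module ℝ V] where
  W : ℤ → Submodule ℝ V
  W_mono : Monotone W
  W_bot : ∃ k, W k = ⊥
  W_top : ∃ k, W k = ⊤
  Q : ∀ w : ℤ, LinearMap.BilinForm ℝ (Gr W w)
  Q_nondegenerate : ∀ w, (Q w).Nondegenerate
  Q_symm : ∀ w x y, Q w x y = (-1 : ℝ) ^ w * Q w y x
  h : ℤ → ℤ → ℕ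
  h_symm : ∀ p q, h p q = h q p
  h_finite : ∀ w, {p | h p (w - p) ≠ 0}.Finite
  h_sum : ∀ w, Module.finrank ℝ (Gr W w) = ∑ᶠ p, h p (w - p)

namespace ClassifyingData

variable {V : Type*} [AddCommGroup V] [Module ℝ V] (D : ClassifyingData V)

/-- The complex bilinear extension to `Gr_{w,ℂ}` of the form on `Gr_w`, evaluated on the classes of
two elements of `W_{w,ℂ}`. -/
def QC (w : ℤ) (u v : Cx V) : ℂ := (D.Q w).baseChange ℂ (grC D.W w u) (grC D.W w v)

/-- The classifying space `M`: all finite decreasing filtrations `F` of `V_ℂ` such that `(F, W)` is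
a mixed Hodge structure whose graded quotients are Hodge structures polarized by the given forms
with the given Hodge numbers. -/
def M : Set (ℤ → Submodule ℂ (Cx V)) :=
  {F | Antitone F ∧ (∃ a, F a = ⊤) ∧ (∃ b, F b = ⊥) ∧
    ∀ w, IsPolarizedHodgeStructure w (D.Q w) D.h (inducedFiltration D.W F w)}

/-! ### The groups and the Lie algebra -/

/-- `G_ℝ`: real automorphisms that preserve `W` and induce isometries of the graded quotients. -/
def GR : Subgroup (V ≃ₗ[ℝ] V) where
  carrier := {g | (∀ w, (D.W w).map g.toLinearMap = D.W w) ∧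
    ∀ w, ∀ x ∈ D.W w, ∀ y ∈ D.W w,
      D.Q w (grMap D.W w (g x)) (grMap D.W w (g y)) = D.Q w (grMap D.W w x) (grMap D.W w y)}
  one_mem' := by
    refine ⟨fun w ↦ ?_, fun w x _ y _ ↦ rfl⟩
    exact Submodule.map_id _
  mul_mem' := by
    rintro a b ⟨ha, ha'⟩ ⟨hb, hb'⟩
    have hbm : ∀ w, ∀ x ∈ D.W w, b x ∈ D.W w := fun w x hx ↦ by
      rw [← hb w]; exact Submodule.mem_map_of_mem hx
    refine ⟨fun w ↦ ?_, fun w x hx y hy ↦ ?_⟩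
    · have : (a * b).toLinearMap = a.toLinearMap ∘ₗ b.toLinearMap := rfl
      rw [this, Submodule.map_comp, hb, ha]
    · rw [← hb' w x hx y hy, ← ha' w _ (hbm w x hx) _ (hbm w y hy)]
      rfl
  inv_mem' := by
    rintro a ⟨ha, ha'⟩
    have hinv : ∀ w, ∀ x ∈ D.W w, a⁻¹ x ∈ D.W w := fun w x hx ↦ by
      rw [← ha w] at hx
      obtain ⟨y, hy, rfl⟩ := hx
      have : a⁻¹ (a y) = y := a.symm_apply_apply y
      simpa [this] using hy
    have hcancel : ∀ x, a (a⁻¹ x) = x := fun x ↦ a.apply_symm_apply x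
    refine ⟨fun w ↦ ?_, fun w x hx y hy ↦ ?_⟩
    · apply le_antisymm
      · rintro _ ⟨x, hx, rfl⟩
        exact hinv w x hx
      · intro x hx
        refine ⟨a x, ?_, a.symm_apply_apply x⟩
        rw [← ha w]; exact Submodule.mem_map_of_mem hx
    · rw [← ha' w _ (hinv w x hx) _ (hinv w y hy), hcancel, hcancel]

/-- `G_ℂ`: complex automorphisms that preserve `W_ℂ` and induce isometries of the complexified
graded quotients. -/
def GC : Subgroup (Cx V ≃ₗ[ℂ] Cx V) where
  carrier := {g | (∀ w, (WC D.W w).map g.toLinearMap = WC D.W w) ∧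
    ∀ w, ∀ x ∈ WC D.W w, ∀ y ∈ WC D.W w, D.QC w (g x) (g y) = D.QC w x y}
  one_mem' := by
    refine ⟨fun w ↦ ?_, fun w x _ y _ ↦ rfl⟩
    exact Submodule.map_id _
  mul_mem' := by
    rintro a b ⟨ha, ha'⟩ ⟨hb, hb'⟩
    have hbm : ∀ w, ∀ x ∈ WC D.W w, b x ∈ WC D.W w := fun w x hx ↦ by
      rw [← hb w]; exact Submodule.mem_map_of_mem hx
    refine ⟨fun w ↦ ?_, fun w x hx y hy ↦ ?_⟩
    · have : (a * b).toLinearMap = a.toLinearMap ∘ₗ b.toLinearMap := rfl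
      rw [this, Submodule.map_comp, hb, ha]
    · rw [← hb' w x hx y hy, ← ha' w _ (hbm w x hx) _ (hbm w y hy)]
      rfl
  inv_mem' := by
    rintro a ⟨ha, ha'⟩
    have hinv : ∀ w, ∀ x ∈ WC D.W w, a⁻¹ x ∈ WC D.W w := fun w x hx ↦ by
      rw [← ha w] at hx
      obtain ⟨y, hy, rfl⟩ := hx
      have : a⁻¹ (a y) = y := a.symm_apply_apply y
      simpa [this] using hy
    have hcancel : ∀ x, a (a⁻¹ x) = x := fun x ↦ a.apply_symm_apply x
    refine ⟨fun w ↦ ?_, fun w x hx y hy ↦ ?_⟩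
    · apply le_antisymm
      · rintro _ ⟨x, hx, rfl⟩
        exact hinv w x hx
      · intro x hx
        refine ⟨a x, ?_, a.symm_apply_apply x⟩
        rw [← ha w]; exact Submodule.mem_map_of_mem hx
    · rw [← ha' w _ (hinv w x hx) _ (hinv w y hy), hcancel, hcancel]

variable {D} in
theorem GC_map_mem (g : D.GC) {w : ℤ} {x : Cx V} (hx : x ∈ WC D.W w) :
    (g : Cx V ≃ₗ[ℂ] Cx V) x ∈ WC D.W w := by
  rw [← g.2.1 w]; exact Submodule.mem_map_of_mem hx

variable {D} in
theorem GC_symm_mem (g : D.GC) {w : ℤ} {x : Cx V} (hx : x ∈ WC D.W w) :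
    (g : Cx V ≃ₗ[ℂ] Cx V).symm x ∈ WC D.W w := by
  have := GC_map_mem g⁻¹ hx
  exact this

/-- The inclusion `G_ℝ → G_ℂ`, `g ↦ id ⊗ g`. -/
def complexify (g : D.GR) : D.GC :=
  ⟨LinearEquiv.baseChange ℝ ℂ V V (g : V ≃ₗ[ℝ] V), by
    have hmem : ∀ w, ∀ x ∈ D.W w, (g : V ≃ₗ[ℝ] V) x ∈ D.W w := fun w x hx ↦ by
      rw [← g.2.1 w]; exact Submodule.mem_map_of_mem hx
    have happ : ∀ (z : ℂ) (v : V), (LinearEquiv.baseChange ℝ ℂ V V (g : V ≃ₗ[ℝ] V)) (z ⊗ₜ[ℝ] v)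
        = z ⊗ₜ[ℝ] ((g : V ≃ₗ[ℝ] V) v) := fun z v ↦ rfl
    refine ⟨fun w ↦ ?_, fun w x hx y hy ↦ ?_⟩
    · unfold WC
      conv_rhs => rw [← g.2.1 w]
      rw [Submodule.baseChange_eq_span, Submodule.map_span, Submodule.baseChange_eq_span]
      congr 1
      ext t
      constructor
      · rintro ⟨_, ⟨x, hx, rfl⟩, rfl⟩
        exact ⟨_, Submodule.mem_map_of_mem hx, rfl⟩
      · rintro ⟨_, ⟨x, hx, rfl⟩, rfl⟩
        exact ⟨_, ⟨x, hx, rfl⟩, rfl⟩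
    · unfold WC at hx hy
      rw [Submodule.baseChange_eq_span] at hx hy
      unfold QC
      induction hx using Submodule.span_induction with
      | zero => simp
      | add a b _ _ ha hb => simp only [map_add, LinearMap.add_apply, ha, hb]
      | smul c a _ ha => simp only [map_smul, LinearMap.smul_apply, ha]
      | mem a ha =>
        induction hy using Submodule.span_induction with
        | zero => simp
        | add a b _ _ ha hb => simp only [map_add, ha, hb]
        | smul c a _ ha => simp only [map_smul, ha]
        | mem b hb =>
          obtain ⟨a, ha, rfl⟩ := ha
          obtain ⟨b, hb, rfl⟩ := hb
          have := g.2.2 w a ha b hb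
          simp only [TensorProduct.mk_apply, happ, grC, LinearMap.baseChange_tmul,
            LinearMap.BilinForm.baseChange_tmul, this]⟩

/-- The Lie algebra `𝔤_ℂ` of `G_ℂ`: endomorphisms that preserve `W_ℂ` and act on the complexified
graded quotients by infinitesimal isometries. -/
def lieC : Submodule ℂ (Module.End ℂ (Cx V)) where
  carrier := {X | (∀ w, ∀ u ∈ WC D.W w, X u ∈ WC D.W w) ∧
    ∀ w, ∀ u ∈ WC D.W w, ∀ v ∈ WC D.W w, D.QC w (X u) v + D.QC w u (X v) = 0}
  zero_mem' := by
    refine ⟨fun w u _ ↦ by simp, fun w u _ v _ ↦ by simp [QC]⟩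
  add_mem' := by
    rintro X Y ⟨hX, hX'⟩ ⟨hY, hY'⟩
    refine ⟨fun w u hu ↦ add_mem (hX w u hu) (hY w u hu), fun w u hu v hv ↦ ?_⟩
    have h1 := hX' w u hu v hv
    have h2 := hY' w u hu v hv
    simp only [QC, LinearMap.add_apply, map_add] at *
    linear_combination h1 + h2
  smul_mem' := by
    rintro c X ⟨hX, hX'⟩
    refine ⟨fun w u hu ↦ Submodule.smul_mem _ c (hX w u hu), fun w u hu v hv ↦ ?_⟩
    have h1 := hX' w u hu v hv
    simp only [QC, LinearMap.smul_apply, map_smul, smul_eq_mul] at *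
    linear_combination c * h1

instance : AddCommGroup D.lieC := Submodule.addCommGroup D.lieC

variable {D}

/-- The adjoint action of `G_ℂ` on `𝔤_ℂ`, `X ↦ g X g⁻¹`. -/
def Ad (g : D.GC) : D.lieC →ₗ[ℂ] D.lieC :=
  (LinearEquiv.conj (g : Cx V ≃ₗ[ℂ] Cx V)).toLinearMap.restrict (by
    rintro X ⟨hX, hX'⟩
    refine ⟨fun w u hu ↦ GC_map_mem g (hX w _ (GC_symm_mem g hu)), fun w u hu v hv ↦ ?_⟩
    have hu' := GC_symm_mem g hu
    have hv' := GC_symm_mem g hv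
    have h1 := g.2.2 w _ (hX w _ hu') _ hv'
    have h2 := g.2.2 w _ hu' _ (hX w _ hv')
    rw [LinearEquiv.apply_symm_apply] at h1 h2
    have h3 := hX' w _ hu' _ hv'
    rw [← h1, ← h2] at h3
    exact h3)

/-- The action of linear automorphisms of `V_ℂ` on filtrations: `(g.F)^p = g(F^p)`. -/
def act (g : Cx V ≃ₗ[ℂ] Cx V) (F : ℤ → Submodule ℂ (Cx V)) : ℤ → Submodule ℂ (Cx V) :=
  fun p ↦ (F p).map g.toLinearMap

variable (D)

/-- The Lie algebra `𝔤_ℂ^F` of the stabilizer of `F` in `G_ℂ`. -/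
def stabilizer (F : ℤ → Submodule ℂ (Cx V)) : Submodule ℂ D.lieC where
  carrier := {X | ∀ p, ∀ v ∈ F p, (X : Module.End ℂ (Cx V)) v ∈ F p}
  zero_mem' := fun p v _ ↦ by simp
  add_mem' := fun {X Y} hX hY p v hv ↦ add_mem (hX p v hv) (hY p v hv)
  smul_mem' := fun c X hX p v hv ↦ Submodule.smul_mem _ c (hX p v hv)

/-- The (holomorphic) tangent space `T_F(M) = 𝔤_ℂ / 𝔤_ℂ^F`.  `M` is open in the homogeneous space
`G_ℂ / G_ℂ^F`, and the class of `X` is the velocity at `t = 0` of the curve `e^{tX}.F`. -/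
abbrev TangentSpace (F : ℤ → Submodule ℂ (Cx V)) : Type _ := ↥(D.lieC) ⧸ D.stabilizer F

variable {D}

/-- The differential `L_{g*} : T_F → T_{g.F}` of left translation by `g`; since
`g e^{tX}.F = e^{t Ad(g)X}.(g.F)`, it is induced by `Ad(g)`.  See `hasVelocity_act`. -/
def pushforward (g : D.GC) (F : ℤ → Submodule ℂ (Cx V)) :
    D.TangentSpace F →ₗ[ℂ] D.TangentSpace (act g F) :=
  Submodule.mapQ _ _ (Ad g) (by
    rintro X hX p _ ⟨v, hv, rfl⟩
    refine ⟨(X : Module.End ℂ (Cx V)) v, hX p v hv, ?_⟩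
    simp [Ad, LinearMap.restrict_apply, LinearEquiv.conj_apply])

/-- The curve `γ` through `F` has velocity `ξ` at `t = 0`: it is of the form `γ(t) = a(t).F` for a
curve `a` in `G_ℂ` through the identity whose derivative at `0` (in terms of matrix coefficients)
represents `ξ`. -/
def HasVelocity (γ : ℝ → ℤ → Submodule ℂ (Cx V)) (F : ℤ → Submodule ℂ (Cx V))
    (ξ : D.TangentSpace F) : Prop :=
  ∃ (a : ℝ → D.GC) (X : D.lieC), a 0 = 1 ∧ Submodule.Quotient.mk X = ξ ∧
    (∀ (v : Cx V) (φ : Module.Dual ℂ (Cx V)),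
      HasDerivAt (fun t ↦ φ ((a t : Cx V ≃ₗ[ℂ] Cx V) v)) (φ ((X : Module.End ℂ (Cx V)) v)) 0) ∧
    ∀ t, γ t = act (a t) F

/-- `pushforward g F` is the differential of `L_g` at `F`: it maps the velocity of a curve to the
velocity of the translated curve. -/
theorem hasVelocity_act (g : D.GC) (γ : ℝ → ℤ → Submodule ℂ (Cx V))
    (F : ℤ → Submodule ℂ (Cx V)) (ξ : D.TangentSpace F) (h : HasVelocity γ F ξ) :
    HasVelocity (fun t ↦ act g (γ t)) (act g F) (pushforward g F ξ) := by
  obtain ⟨a, X, ha, rfl, hd, hγ⟩ := h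
  refine ⟨fun t ↦ g * a t * g⁻¹, Ad g X, by simp [ha], rfl, fun v φ ↦ ?_, fun t ↦ ?_⟩
  · exact hd ((g : Cx V ≃ₗ[ℂ] Cx V).symm v) (φ ∘ₗ (g : Cx V ≃ₗ[ℂ] Cx V).toLinearMap)
  · funext p
    simp only [hγ, act]
    rw [← Submodule.map_comp, ← Submodule.map_comp]
    congr 1
    refine LinearMap.ext fun v ↦ ?_
    have hv : (g : Cx V ≃ₗ[ℂ] Cx V)⁻¹ ((g : Cx V ≃ₗ[ℂ] Cx V) v) = v :=
      (g : Cx V ≃ₗ[ℂ] Cx V).symm_apply_apply v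
    simp [hv]

/-! ### The Deligne bigrading -/

variable (D)

/-- Deligne's bigrading of the mixed Hodge structure `(F, W)`:
`I^{p,q} = F^p ∩ W_{p+q} ∩ (F̄^q ∩ W_{p+q} + ∑_{j ≥ 2} F̄^{q-j+1} ∩ W_{p+q-j})`.
It is the unique bigrading with `F^p = ⊕_{a ≥ p} I^{a,b}`, `W_k = ⊕_{a+b ≤ k} I^{a,b}` and
`I^{p,q} ≡ Ī^{q,p}` modulo `⊕_{r<p, s<q} I^{r,s}`. -/
def I (F : ℤ → Submodule ℂ (Cx V)) (p q : ℤ) : Submodule ℂ (Cx V) :=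
  F p ⊓ WC D.W (p + q) ⊓
    ((conjSub (F q) ⊓ WC D.W (p + q)) ⊔
      ⨆ j : ℤ, ⨆ _ : 2 ≤ j, conjSub (F (q - j + 1)) ⊓ WC D.W (p + q - j))

open Classical in
/-- The projection of `V_ℂ = ⊕ I^{p,q}` onto `I^{p,q}`. -/
def proj (F : ℤ → Submodule ℂ (Cx V)) (p q : ℤ) : Module.End ℂ (Cx V) :=
  if h : IsCompl (D.I F p q) (⨆ r : ℤ × ℤ, ⨆ _ : r ≠ (p, q), D.I F r.1 r.2) then
    Submodule.projection _ _ h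
  else 0

/-- The Hodge component `X^{p,q}` of an endomorphism `X` of `V_ℂ`: the part that maps every
`I^{r,s}` to `I^{r+p,s+q}`. -/
def component (F : ℤ → Submodule ℂ (Cx V)) (p q : ℤ) (X : Module.End ℂ (Cx V)) :
    Module.End ℂ (Cx V) :=
  ∑ᶠ r : ℤ × ℤ, D.proj F (r.1 + p) (r.2 + q) * X * D.proj F r.1 r.2

/-- The Deligne bigrading `𝔤^{p,q}` of the induced mixed Hodge structure on `𝔤_ℂ`. -/
def g (F : ℤ → Submodule ℂ (Cx V)) (p q : ℤ) : Submodule ℂ D.lieC where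
  carrier := {X | ∀ r s, ∀ v ∈ D.I F r s, (X : Module.End ℂ (Cx V)) v ∈ D.I F (r + p) (s + q)}
  zero_mem' := fun r s v _ ↦ by simp
  add_mem' := fun {X Y} hX hY r s v hv ↦ add_mem (hX r s v hv) (hY r s v hv)
  smul_mem' := fun c X hX r s v hv ↦ Submodule.smul_mem _ c (hX r s v hv)

/-- `q_F = ⊕_{p < 0, p + q ≤ 0} 𝔤^{p,q}`, a complement of `𝔤_ℂ^F` in `𝔤_ℂ`. -/
def qF (F : ℤ → Submodule ℂ (Cx V)) : Submodule ℂ D.lieC :=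
  ⨆ p : ℤ, ⨆ q : ℤ, ⨆ _ : p < 0 ∧ p + q ≤ 0, D.g F p q

/-- `X` belongs to `Λ^{-1,-1} = ⊕_{a,b<0} 𝔤𝔩(V_ℂ)^{a,b}`. -/
def InLambda (F : ℤ → Submodule ℂ (Cx V)) (X : Module.End ℂ (Cx V)) : Prop :=
  ∀ p q, ∀ v ∈ D.I F p q, X v ∈ ⨆ a : ℤ, ⨆ b : ℤ, ⨆ _ : a < p ∧ b < q, D.I F a b

/-- `(F, W)` is split over `ℝ`: `I^{p,q}` is the conjugate of `I^{q,p}`. -/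
def IsSplit (F : ℤ → Submodule ℂ (Cx V)) : Prop :=
  ∀ p q, D.I F p q = conjSub (D.I F q p)

/-! ### The canonical splitting -/

/-- Exponential of a nilpotent endomorphism. -/
def expN (X : Module.End ℂ (Cx V)) : Module.End ℂ (Cx V) := IsNilpotent.exp X

/-- The filtration `X.F` for an endomorphism `X` of `V_ℂ`. -/
def actEnd (X : Module.End ℂ (Cx V)) (F : ℤ → Submodule ℂ (Cx V)) : ℤ → Submodule ℂ (Cx V) :=
  fun p ↦ (F p).map X

/-- Deligne's `δ`-splitting: `δ` is real, lies in `Λ^{-1,-1}`, and `(e^{-iδ}.F, W)` is split over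
`ℝ`.  It is unique. -/
def IsDelta (F : ℤ → Submodule ℂ (Cx V)) (δ : Module.End ℝ V) : Prop :=
  D.InLambda F (δ.baseChange ℂ) ∧
    D.IsSplit (actEnd (expN (-(Complex.I • δ.baseChange ℂ))) F)

/-- The integers `b^k_{p,q}` with `(1 - x)^p (1 + x)^q = ∑_k b^k_{p,q} x^k`. -/
def b (k p q : ℕ) : ℤ :=
  ((1 - Polynomial.X) ^ p * (1 + Polynomial.X) ^ q : Polynomial ℤ).coeff k

/-- `C_{j+1}(η) = i ∑_{p,q ≥ 1} b^{j-1}_{p-1,q-1} η^{-p,-q}` for `j ≥ 1`; the argument `k` is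
`j - 1`, and `r = (p - 1, q - 1)`. -/
def C (F : ℤ → Submodule ℂ (Cx V)) (η : Module.End ℂ (Cx V)) (k : ℕ) : Module.End ℂ (Cx V) :=
  Complex.I • ∑ᶠ r : ℕ × ℕ,
    ((b k r.1 r.2 : ℤ) : ℂ) • D.component F (-((r.1 : ℤ) + 1)) (-((r.2 : ℤ) + 1)) η

/-- The noncommutative polynomials `P_k = P_k(C_2, …, C_{k+1})`: `P_0 = 1` and
`P_k = -(1/k) ∑_{j=1}^k P_{k-j} C_{j+1}`. -/
def P (F : ℤ → Submodule ℂ (Cx V)) (η : Module.End ℂ (Cx V)) : ℕ → Module.End ℂ (Cx V)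
  | 0 => 1
  | k + 1 => -((k + 1 : ℂ)⁻¹ • ∑ j : Fin (k + 1), P F η (k - j) * D.C F η j)

/-- The relation between `δ`, `ζ` and the auxiliary element `η`, which determines `ζ` and `η` as
universal Lie polynomials in the Hodge components of `δ`:  `ζ` and `η` are real, lie in
`Λ^{-1,-1}`, and `e^{iδ} = e^ζ (1 + ∑_{k ≥ 1} P_k(C_2, …, C_{k+1}))`.  The Hodge components are
taken with respect to the split mixed Hodge structure `(e^{-iδ}.F, W)`. -/
def IsZeta (F : ℤ → Submodule ℂ (Cx V)) (δ ζ η : Module.End ℝ V) : Prop :=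
  D.InLambda F (ζ.baseChange ℂ) ∧ D.InLambda F (η.baseChange ℂ) ∧
    expN (Complex.I • δ.baseChange ℂ) = expN (ζ.baseChange ℂ) *
      ∑ᶠ k, D.P (actEnd (expN (-(Complex.I • δ.baseChange ℂ))) F) (η.baseChange ℂ) k

/-- `ε = ε(F, W)` is the element of `Λ^{-1,-1}` with `e^ε = e^{iδ} e^{-ζ}`, so that
`(e^{-ε}.F, W)` is the canonical (`SL_2`) splitting of `(F, W)`. -/
def IsEpsilon (F : ℤ → Submodule ℂ (Cx V)) (ε : Module.End ℂ (Cx V)) : Prop :=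
  D.InLambda F ε ∧ ∃ δ ζ η : Module.End ℝ V, D.IsDelta F δ ∧ D.IsZeta F δ ζ η ∧
    expN ε = expN (Complex.I • δ.baseChange ℂ) * expN (-(ζ.baseChange ℂ))

open Classical in
/-- The element `ε(F, W)`, which exists uniquely for every mixed Hodge structure `(F, W)`. -/
def epsilon (F : ℤ → Submodule ℂ (Cx V)) : Module.End ℂ (Cx V) :=
  if h : ∃! ε, D.IsEpsilon F ε then h.choose else 0

/-! ### The standard and the twisted metric -/

/-- The hermitian form on `V_ℂ` for which the `I^{p,q}` are mutually orthogonal and which is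
`t^{p+q} i^{p-q} ⟨gr u, gr v̄⟩_{p+q}` for `u, v ∈ I^{p,q}`: the mixed Hodge metric, with the norm on
`I^{p,q}` scaled by `t^{(p+q)/2}`. -/
def scaledMetric (t : ℝ) (F : ℤ → Submodule ℂ (Cx V)) (u v : Cx V) : ℂ :=
  ∑ᶠ r : ℤ × ℤ, (t : ℂ) ^ (r.1 + r.2) * (Complex.I ^ (r.1 - r.2) *
    D.QC (r.1 + r.2) (D.proj F r.1 r.2 u) (conj (D.proj F r.1 r.2 v)))

/-- The mixed Hodge metric on `V_ℂ` (linear in the first variable). -/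
def hodgeMetric (F : ℤ → Submodule ℂ (Cx V)) : Cx V → Cx V → ℂ := D.scaledMetric 1 F

variable {D} in
open Classical in
/-- The adjoint `X^*` of `X` with respect to a (positive definite) hermitian form `H`: the unique
endomorphism with `H(Xu, v) = H(u, X^* v)`. -/
def adjoint (H : Cx V → Cx V → ℂ) (X : Module.End ℂ (Cx V)) : Module.End ℂ (Cx V) :=
  if h : ∃! Y : Module.End ℂ (Cx V), ∀ u v, H (X u) v = H u (Y v) then h.choose else 0

variable {D} in
/-- The hermitian form `(X, Y) ↦ Tr(X Y^*)` on `𝔤𝔩(V_ℂ)` that is induced by `H`. -/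
def traceForm (H : Cx V → Cx V → ℂ) (X Y : Module.End ℂ (Cx V)) : ℂ :=
  LinearMap.trace ℂ (Cx V) (X * adjoint H Y)

/-- The norm `‖X‖` of an endomorphism of `V_ℂ` for the standard metric at `F`. -/
def stdNorm (F : ℤ → Submodule ℂ (Cx V)) (X : Module.End ℂ (Cx V)) : ℝ :=
  √(traceForm (D.hodgeMetric F) X X).re

/-- The twisting function `τ(F) = 1 + ∑_{p,q<0} ‖ε^{p,q}‖^{-2/(p+q)}`, the Hodge components of
`ε = ε(F, W)` and the norm being taken with respect to `(F, W)`. -/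
def tau (F : ℤ → Submodule ℂ (Cx V)) : ℝ :=
  1 + ∑ᶠ (r : ℤ × ℤ) (_ : r.1 < 0 ∧ r.2 < 0),
    D.stdNorm F (D.component F r.1 r.2 (D.epsilon F)) ^ (-(2 : ℝ) / ((r.1 : ℝ) + (r.2 : ℝ)))

/-- The twisted metric on `V_ℂ` at `F`: the mixed Hodge metric with the norm on `I^{p,q}` scaled by
`τ(F)^{(p+q)/2}`. -/
def twistedMetric (F : ℤ → Submodule ℂ (Cx V)) : Cx V → Cx V → ℂ := D.scaledMetric (D.tau F) F

open Classical in
/-- The identification `T_F(M) ≅ q_F`: the unique representative of a tangent vector in `q_F`. -/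
def lift (F : ℤ → Submodule ℂ (Cx V)) (ξ : D.TangentSpace F) : Module.End ℂ (Cx V) :=
  if h : ∃! X : D.lieC, X ∈ D.qF F ∧ Submodule.Quotient.mk X = ξ then h.choose else 0

/-- The twisted metric `h_τ` on the tangent space `T_F(M) ≅ q_F ⊆ 𝔤𝔩(V_ℂ)`:
`h_τ(α, β) = Tr(α β^*)`, the adjoint being taken with respect to the twisted metric on `V_ℂ`. -/
def hTau (F : ℤ → Submodule ℂ (Cx V)) (ξ ξ' : D.TangentSpace F) : ℂ :=
  traceForm (D.twistedMetric F) (D.lift F ξ) (D.lift F ξ')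

end ClassifyingData

end MixedHodge

end

open scoped TensorProduct

noncomputable section

namespace MixedHodge

/-! ### Transport along a linear automorphism of V_ℂ. -/

section Generalities

variable {V : Type*} [AddCommGroup V] [Module ℝ V]

/-! The proof is transport of structure. An element g of G_ℝ preserves W, induces isometries of the
graded quotients and, being real, commutes with conjugation on V_ℂ. The Deligne spaces are built
from F, its conjugate and W by sums and intersections, so g carries I^{p,q} of F to I^{p,q} of g.F
(`I_act`). Projections, Hodge components, the predicates that define δ, ζ, ε, and the space q_F then
all correspond under conjugation by g.

Objects specified by unique existence (ε, the adjoint, the lift to q_F) correspond because g matches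
the solutions on the two sides; if unique existence failed, it would fail on both sides and both
defaults would be 0. Thus neither existence of the splittings nor positivity of the metrics has to
be proved.

Since ε is equivariant and g is an isometry of mixed Hodge metrics, τ(g.F) = τ(F) (`tau_act`). Hence
g is also an isometry of twisted metrics, and invariance of the trace under conjugation gives
`hTau_act`. Stability of the classifying space (`act_mem_M`) comes from the isometries of Gr_w
induced by g. -/

theorem map_dite_existsUnique_choose {α β : Type*} [Zero α] [Zero β] (f : α → β)
    (hf0 : f 0 = 0) {P : α → Prop} {Q : β → Prop} (hf : Function.Bijective f)
    (h : ∀ a, P a ↔ Q (f a)) {_ : Decidable (∃! a, P a)} {_ : Decidable (∃! b, Q b)} :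
    (if h : ∃! b, Q b then h.choose else 0) = f (if h : ∃! a, P a then h.choose else 0) := by
  have key : (∃! a, P a) ↔ ∃! b, Q b := by
    rw [hf.existsUnique_iff]
    simp only [h]
  by_cases hP : ∃! a, P a
  · have hQ := key.1 hP
    rw [dif_pos hP, dif_pos hQ]
    exact hQ.unique hQ.choose_spec.1 ((h _).1 hP.choose_spec.1)
  · rw [dif_neg hP, dif_neg (mt key.2 hP), hf0]

theorem map_equiv_inf {R M : Type*} [Ring R] [AddCommGroup M] [Module R M] (e : M ≃ₗ[R] M)
    (S T : Submodule R M) :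
    (S ⊓ T).map e.toLinearMap = S.map e.toLinearMap ⊓ T.map e.toLinearMap :=
  Submodule.map_inf _ e.injective

theorem mem_map_equiv_apply {R M : Type*} [Ring R] [AddCommGroup M] [Module R M] (e : M ≃ₗ[R] M)
    {S : Submodule R M} {x : M} : e x ∈ S.map e.toLinearMap ↔ x ∈ S :=
  Function.Injective.mem_set_image e.injective

theorem isCompl_map_equiv {R M : Type*} [Ring R] [AddCommGroup M] [Module R M] (e : M ≃ₗ[R] M)
    {S T : Submodule R M} :
    IsCompl (S.map e.toLinearMap) (T.map e.toLinearMap) ↔ IsCompl S T :=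
  ((Submodule.orderIsoMapComap e).isCompl_iff (x := S) (y := T)).symm

/-- Split x into its components in S and T; e sends them into e(S) and e(T), where the new
projection is the identity and zero respectively. -/
theorem projection_map_equiv {R M : Type*} [Ring R] [AddCommGroup M] [Module R M] (e : M ≃ₗ[R] M)
    {S T : Submodule R M} (h : IsCompl S T)
    (h' : IsCompl (S.map e.toLinearMap) (T.map e.toLinearMap)) (x : M) :
    Submodule.projection _ _ h' (e x) = e (Submodule.projection _ _ h x) := by
  have hx := Submodule.projection_add_projection_eq_self h x
  conv_lhs => rw [← hx, map_add, map_add]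
  rw [Submodule.projection_apply_of_mem_left h'
      ((mem_map_equiv_apply e).2 (Submodule.projection_apply_mem h x)),
    Submodule.projection_apply_of_mem_right h'
      ((mem_map_equiv_apply e).2 (Submodule.projection_apply_mem h.symm x)), add_zero]

theorem conj_baseChange {V' : Type*} [AddCommGroup V'] [Module ℝ V'] (f : V →ₗ[ℝ] V') (x : Cx V) :
    conj (f.baseChange ℂ x) = f.baseChange ℂ (conj x) := by
  induction x using TensorProduct.induction_on with
  | zero => simp
  | tmul z v => simp [conj_tmul]
  | add x y hx hy => simp only [map_add, hx, hy]

/-- Reality of `e` is essential: a general complex automorphism does not respect conjugate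
subspaces. -/
theorem conjSub_map {e : Cx V ≃ₗ[ℂ] Cx V} (he : ∀ x, conj (e x) = e (conj x))
    (S : Submodule ℂ (Cx V)) :
    conjSub (S.map e.toLinearMap) = (conjSub S).map e.toLinearMap := by
  ext x
  obtain ⟨y, rfl⟩ := e.surjective x
  rw [mem_map_equiv_apply]
  change conj (e y) ∈ S.map e.toLinearMap ↔ _
  rw [he, mem_map_equiv_apply]
  rfl

theorem baseChange_isometry {E : Type*} [AddCommGroup E] [Module ℝ E] (Q : LinearMap.BilinForm ℝ E)
    (f : E →ₗ[ℝ] E) (hf : ∀ x y, Q (f x) (f y) = Q x y) (u v : Cx E) :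
    Q.baseChange ℂ (f.baseChange ℂ u) (f.baseChange ℂ v) = Q.baseChange ℂ u v := by
  induction u using TensorProduct.induction_on with
  | zero => simp
  | add x y hx hy => simp only [map_add, LinearMap.add_apply, hx, hy]
  | tmul z x =>
    induction v using TensorProduct.induction_on with
    | zero => simp
    | add x y hx hy => simp only [map_add, hx, hy]
    | tmul z' y => simp only [LinearMap.baseChange_tmul, LinearMap.BilinForm.baseChange_tmul, hf]

/-- Isometries of the polarization transport polarized Hodge structures. -/
theorem IsPolarizedHodgeStructure.map {E : Type*} [AddCommGroup E] [Module ℝ E] {w : ℤ}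
    {Q : LinearMap.BilinForm ℝ E} {h : ℤ → ℤ → ℕ} {Φ : ℤ → Submodule ℂ (Cx E)}
    (H : IsPolarizedHodgeStructure w Q h Φ) (f : E ≃ₗ[ℝ] E) (hf : ∀ x y, Q (f x) (f y) = Q x y) :
    IsPolarizedHodgeStructure w Q h
      fun p ↦ (Φ p).map (LinearEquiv.baseChange ℝ ℂ E E f).toLinearMap := by
  have hc (x : Cx E) : conj (LinearEquiv.baseChange ℝ ℂ E E f x) =
      LinearEquiv.baseChange ℝ ℂ E E f (conj x) := conj_baseChange f.toLinearMap x
  have hQ (u v : Cx E) : Q.baseChange ℂ (LinearEquiv.baseChange ℝ ℂ E E f u)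
      (LinearEquiv.baseChange ℝ ℂ E E f v) = Q.baseChange ℂ u v :=
    baseChange_isometry Q f.toLinearMap hf u v
  refine ⟨fun p ↦ ?_, fun p q hpq ↦ ?_, fun p q hpq ↦ ?_, fun p q hpq ↦ ?_⟩
  · rw [conjSub_map hc, isCompl_map_equiv]
    exact H.opposed p
  · rw [conjSub_map hc, ← map_equiv_inf]
    exact (LinearEquiv.finrank_map_eq _ _).trans (H.hodgeNumber p q hpq)
  · rintro _ ⟨u, hu, rfl⟩ _ ⟨v, hv, rfl⟩
    exact (hQ u v).trans (H.isotropic p q hpq u hu v hv)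
  · rw [conjSub_map hc, ← map_equiv_inf]
    rintro _ ⟨u, hu, rfl⟩ hne
    have := H.positive p q hpq u hu (by rintro rfl; simp at hne)
    change 0 < (_ * Q.baseChange ℂ (LinearEquiv.baseChange ℝ ℂ E E f u)
      (conj (LinearEquiv.baseChange ℝ ℂ E E f u))).re
    rwa [hc, hQ]

theorem nilpotencyClass_map {R S : Type*} [Ring R] [Ring S] (f : R ≃+* S) (a : R) :
    nilpotencyClass (f a) = nilpotencyClass a := by
  simp only [nilpotencyClass, ← map_pow, map_eq_zero_iff f f.injective]

/-- `IsNilpotent.exp` is a sum truncated at the nilpotency class, which conjugation preserves, so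
the identity holds for every X, nilpotent or not. -/
theorem expN_conj (e : Cx V ≃ₗ[ℂ] Cx V) (X : Module.End ℂ (Cx V)) :
    ClassifyingData.expN (e.conjAlgEquiv ℂ X) = e.conjAlgEquiv ℂ (ClassifyingData.expN X) := by
  simp only [ClassifyingData.expN, IsNilpotent.exp, map_sum, map_rat_smul, map_pow]
  rw [show nilpotencyClass (e.conjAlgEquiv ℂ X) = _ from
    nilpotencyClass_map (e.conjAlgEquiv ℂ).toRingEquiv X]

theorem conjAlgEquiv_apply_apply (e : Cx V ≃ₗ[ℂ] Cx V) (X : Module.End ℂ (Cx V)) (v : Cx V) :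
    e.conjAlgEquiv ℂ X (e v) = e (X v) := by
  simp [LinearEquiv.conjAlgEquiv_apply]

theorem trace_conjAlgEquiv (e : Cx V ≃ₗ[ℂ] Cx V) (X : Module.End ℂ (Cx V)) :
    LinearMap.trace ℂ (Cx V) (e.conjAlgEquiv ℂ X) = LinearMap.trace ℂ (Cx V) X :=
  LinearMap.trace_conj' X e

theorem adjoint_conj (e : Cx V ≃ₗ[ℂ] Cx V) {H H' : Cx V → Cx V → ℂ}
    (hH : ∀ u v, H' (e u) (e v) = H u v) (X : Module.End ℂ (Cx V)) :
    ClassifyingData.adjoint H' (e.conjAlgEquiv ℂ X) =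
      e.conjAlgEquiv ℂ (ClassifyingData.adjoint H X) := by
  unfold ClassifyingData.adjoint
  refine map_dite_existsUnique_choose (e.conjAlgEquiv ℂ) (map_zero _)
    (e.conjAlgEquiv ℂ).bijective fun Y ↦ ?_
  conv_rhs => rw [e.surjective.forall₂]
  simp_rw [conjAlgEquiv_apply_apply, hH]

theorem traceForm_conj (e : Cx V ≃ₗ[ℂ] Cx V) {H H' : Cx V → Cx V → ℂ}
    (hH : ∀ u v, H' (e u) (e v) = H u v) (X Y : Module.End ℂ (Cx V)) :
    ClassifyingData.traceForm H' (e.conjAlgEquiv ℂ X) (e.conjAlgEquiv ℂ Y) =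
      ClassifyingData.traceForm H X Y := by
  rw [ClassifyingData.traceForm, adjoint_conj e hH, ← map_mul, trace_conjAlgEquiv,
    ClassifyingData.traceForm]

theorem actEnd_conj (e : Cx V ≃ₗ[ℂ] Cx V) (X : Module.End ℂ (Cx V))
    (F : ℤ → Submodule ℂ (Cx V)) :
    ClassifyingData.actEnd (e.conjAlgEquiv ℂ X) (ClassifyingData.act e F) =
      ClassifyingData.act e (ClassifyingData.actEnd X F) := by
  funext p
  simp only [ClassifyingData.actEnd, ClassifyingData.act, ← Submodule.map_comp]
  congr 1
  ext v
  simp [LinearEquiv.conjAlgEquiv_apply]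

end Generalities

/-! ### Equivariance of the Deligne bigrading and of Hodge components. -/

namespace ClassifyingData

variable {V : Type*} [AddCommGroup V] [Module ℝ V] {D : ClassifyingData V}

/-- The action of `G_ℝ` on `V_ℂ`. -/
abbrev cxEquiv (g : D.GR) : Cx V ≃ₗ[ℂ] Cx V := D.complexify g

/-- The action of `G_ℝ` on endomorphisms of `V_ℂ` by conjugation. -/
abbrev cxConj (g : D.GR) : Module.End ℂ (Cx V) ≃ₐ[ℂ] Module.End ℂ (Cx V) :=
  (cxEquiv g).conjAlgEquiv ℂ

theorem conj_cxEquiv (g : D.GR) (x : Cx V) : conj (cxEquiv g x) = cxEquiv g (conj x) :=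
  conj_baseChange (g : V ≃ₗ[ℝ] V).toLinearMap x

theorem map_WC (g : D.GR) (w : ℤ) : (WC D.W w).map (cxEquiv g).toLinearMap = WC D.W w :=
  (D.complexify g).2.1 w

/-- W_{w,ℂ} is spanned by real vectors, which conjugation fixes. -/
theorem conj_mem_WC {W : ℤ → Submodule ℝ V} {w : ℤ} {x : Cx V} (hx : x ∈ WC W w) :
    conj x ∈ WC W w := by
  unfold WC at hx ⊢
  rw [Submodule.baseChange_eq_span] at hx
  induction hx using Submodule.span_induction with
  | zero => simp
  | add a b _ _ ha hb => rw [map_add]; exact add_mem ha hb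
  | smul c a _ ha => rw [map_smulₛₗ]; exact Submodule.smul_mem _ _ ha
  | mem a ha =>
    obtain ⟨a, ha, rfl⟩ := ha
    rw [TensorProduct.mk_apply, conj_tmul, map_one]
    exact Submodule.tmul_mem_baseChange_of_mem _ ha

/-- Direct image under g commutes with sums, intersections and conjugation, and fixes each W_{k,ℂ}.
-/
theorem I_act (g : D.GR) (F : ℤ → Submodule ℂ (Cx V)) (p q : ℤ) :
    D.I (act (cxEquiv g) F) p q = (D.I F p q).map (cxEquiv g).toLinearMap := by
  simp only [I, map_equiv_inf, Submodule.map_sup, Submodule.map_iSup, act,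
    conjSub_map (conj_cxEquiv g), map_WC]

theorem apply_mem_I_act (g : D.GR) (F : ℤ → Submodule ℂ (Cx V)) (p q : ℤ) (v : Cx V) :
    cxEquiv g v ∈ D.I (act (cxEquiv g) F) p q ↔ v ∈ D.I F p q := by
  rw [I_act, mem_map_equiv_apply]

theorem proj_act (g : D.GR) (F : ℤ → Submodule ℂ (Cx V)) (p q : ℤ) :
    D.proj (act (cxEquiv g) F) p q = cxConj g (D.proj F p q) := by
  have key : (⨆ r : ℤ × ℤ, ⨆ _ : r ≠ (p, q), D.I (act (cxEquiv g) F) r.1 r.2) =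
      (⨆ r : ℤ × ℤ, ⨆ _ : r ≠ (p, q), D.I F r.1 r.2).map (cxEquiv g).toLinearMap := by
    simp only [Submodule.map_iSup, I_act]
  unfold proj
  -- The projection depends on the proof of complementarity, so the subspaces have to be rewritten
  -- together with that proof.
  rw! [key, I_act]
  by_cases h : IsCompl (D.I F p q) (⨆ r : ℤ × ℤ, ⨆ _ : r ≠ (p, q), D.I F r.1 r.2)
  · have h' := (isCompl_map_equiv (cxEquiv g)).2 h
    rw [dif_pos h, dif_pos h']
    refine LinearMap.ext fun x ↦ ?_
    obtain ⟨y, rfl⟩ := (cxEquiv g).surjective x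
    rw [conjAlgEquiv_apply_apply]
    exact projection_map_equiv _ h h' y
  · rw [dif_neg h, dif_neg (mt (isCompl_map_equiv (cxEquiv g)).1 h), map_zero]

theorem component_act (g : D.GR) (F : ℤ → Submodule ℂ (Cx V)) (p q : ℤ)
    (X : Module.End ℂ (Cx V)) :
    D.component (act (cxEquiv g) F) p q (cxConj g X) = cxConj g (D.component F p q X) := by
  -- An additive equivalence preserves finiteness of support, so it commutes with `finsum` without
  -- any finiteness check.
  have := (cxConj g).toAddEquiv.map_finsum
    (fun r : ℤ × ℤ ↦ D.proj F (r.1 + p) (r.2 + q) * X * D.proj F r.1 r.2)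
  refine Eq.trans ?_ this.symm
  refine finsum_congr fun r ↦ ?_
  change _ = cxConj g _
  rw [proj_act, proj_act, map_mul, map_mul]

theorem inLambda_act (g : D.GR) (F : ℤ → Submodule ℂ (Cx V)) (X : Module.End ℂ (Cx V)) :
    D.InLambda F X ↔ D.InLambda (act (cxEquiv g) F) (cxConj g X) := by
  refine forall_congr' fun p ↦ forall_congr' fun q ↦ ?_
  conv_rhs => rw [(cxEquiv g).surjective.forall]
  simp only [conjAlgEquiv_apply_apply, I_act, ← Submodule.map_iSup, mem_map_equiv_apply]

theorem isSplit_act (g : D.GR) (F : ℤ → Submodule ℂ (Cx V)) :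
    D.IsSplit F ↔ D.IsSplit (act (cxEquiv g) F) := by
  refine forall_congr' fun p ↦ forall_congr' fun q ↦ ?_
  rw [I_act, I_act, conjSub_map (conj_cxEquiv g)]
  exact (Submodule.map_injective_of_injective (cxEquiv g).injective).eq_iff.symm

/-! ### Equivariance of δ, ζ, η and ε. -/

/-- The action of `G_ℝ` on endomorphisms of `V` by conjugation. -/
abbrev realConj (g : D.GR) : Module.End ℝ V ≃ₐ[ℝ] Module.End ℝ V :=
  (g : V ≃ₗ[ℝ] V).conjAlgEquiv ℝ

/-- The elements δ, ζ, η range over real endomorphisms but enter the equations through their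
complexifications; functoriality of base change links the two conjugations. -/
theorem baseChange_realConj (g : D.GR) (X : Module.End ℝ V) :
    (realConj g X).baseChange ℂ = cxConj g (X.baseChange ℂ) := by
  refine LinearMap.ext fun x ↦ ?_
  obtain ⟨y, rfl⟩ := (cxEquiv g).surjective x
  rw [conjAlgEquiv_apply_apply]
  have h : ∀ z : Cx V, cxEquiv g z = (g : V ≃ₗ[ℝ] V).toLinearMap.baseChange ℂ z := fun _ ↦ rfl
  rw [h, h, ← LinearMap.comp_apply, ← LinearMap.comp_apply, ← LinearMap.baseChange_comp,
    ← LinearMap.baseChange_comp]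
  congr 2
  ext v
  simp [LinearEquiv.conjAlgEquiv_apply]

/-- This is (g e^{-iδ} g⁻¹).(g.F) = g.(e^{-iδ}.F). It serves both the splitting condition on δ and
the Hodge components of η, which are taken at e^{-iδ}.F. -/
theorem deltaSplitting_act (g : D.GR) (F : ℤ → Submodule ℂ (Cx V)) (δ : Module.End ℝ V) :
    actEnd (expN (-(Complex.I • (realConj g δ).baseChange ℂ))) (act (cxEquiv g) F) =
      act (cxEquiv g) (actEnd (expN (-(Complex.I • δ.baseChange ℂ))) F) := by
  rw [baseChange_realConj, ← map_smul, ← map_neg, expN_conj, actEnd_conj]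

theorem isDelta_act (g : D.GR) (F : ℤ → Submodule ℂ (Cx V)) (δ : Module.End ℝ V) :
    D.IsDelta F δ ↔ D.IsDelta (act (cxEquiv g) F) (realConj g δ) := by
  unfold IsDelta
  rw [deltaSplitting_act, ← isSplit_act, baseChange_realConj, ← inLambda_act]

theorem C_act (g : D.GR) (F : ℤ → Submodule ℂ (Cx V)) (η : Module.End ℂ (Cx V)) (k : ℕ) :
    D.C (act (cxEquiv g) F) (cxConj g η) k = cxConj g (D.C F η k) := by
  unfold C
  rw [map_smul]
  congr 1
  refine Eq.trans (finsum_congr fun r ↦ ?_) ((cxConj g).toAddEquiv.map_finsum _).symm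
  change _ = cxConj g _
  rw [map_smul, component_act]

theorem P_act (g : D.GR) (F : ℤ → Submodule ℂ (Cx V)) (η : Module.End ℂ (Cx V)) (k : ℕ) :
    D.P (act (cxEquiv g) F) (cxConj g η) k = cxConj g (D.P F η k) := by
  -- The recursion for P_k involves all earlier P_{k-j}.
  induction k using Nat.strong_induction_on with
  | _ k ih =>
    cases k with
    | zero => rw [P, P, map_one]
    | succ k =>
      rw [P, P, map_neg, map_smul, map_sum]
      congr 2
      refine Finset.sum_congr rfl fun j _ ↦ ?_
      rw [map_mul, C_act, ih _ (by omega)]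

theorem isZeta_act (g : D.GR) (F : ℤ → Submodule ℂ (Cx V)) (δ ζ η : Module.End ℝ V) :
    D.IsZeta F δ ζ η ↔
      D.IsZeta (act (cxEquiv g) F) (realConj g δ) (realConj g ζ) (realConj g η) := by
  unfold IsZeta
  rw [deltaSplitting_act]
  simp only [baseChange_realConj, ← inLambda_act, P_act, ← map_smul, expN_conj]
  have := (cxConj g).toAddEquiv.map_finsum
    (D.P (actEnd (expN (-(Complex.I • δ.baseChange ℂ))) F) (η.baseChange ℂ))
  rw [show (∑ᶠ k, cxConj g (D.P (actEnd (expN (-(Complex.I • δ.baseChange ℂ))) F)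
    (η.baseChange ℂ) k)) = cxConj g _ from this.symm, ← map_mul, (cxConj g).injective.eq_iff]

theorem isEpsilon_act (g : D.GR) (F : ℤ → Submodule ℂ (Cx V)) (ε : Module.End ℂ (Cx V)) :
    D.IsEpsilon F ε ↔ D.IsEpsilon (act (cxEquiv g) F) (cxConj g ε) := by
  unfold IsEpsilon
  rw [← inLambda_act]
  refine and_congr_right fun _ ↦ ?_
  -- Every candidate δ, ζ, η at g.F is the conjugate of one at F, so the existential quantifiers can
  -- be matched witness by witness.
  have hs := (realConj g).surjective
  conv_rhs => rw [hs.exists]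
  refine exists_congr fun δ ↦ ?_
  conv_rhs => rw [hs.exists₂]
  refine exists_congr fun ζ ↦ exists_congr fun η ↦ ?_
  rw [← isDelta_act, ← isZeta_act, baseChange_realConj, baseChange_realConj, ← map_smul,
    ← map_neg, expN_conj, expN_conj, expN_conj, ← map_mul, (cxConj g).injective.eq_iff]

theorem epsilon_act (g : D.GR) (F : ℤ → Submodule ℂ (Cx V)) :
    D.epsilon (act (cxEquiv g) F) = cxConj g (D.epsilon F) :=
  map_dite_existsUnique_choose (cxConj g) (map_zero _) (cxConj g).bijective (isEpsilon_act g F)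

/-! ### Invariance of the metrics and of τ. -/

theorem proj_mem_WC (F : ℤ → Submodule ℂ (Cx V)) (p q : ℤ) (v : Cx V) :
    D.proj F p q v ∈ WC D.W (p + q) := by
  unfold proj
  split_ifs with h
  · exact (Submodule.projection_apply_mem h v).1.2
  · simp

/-- The isometry condition on g is available only on W_{w,ℂ}; the projections of u and v and their
conjugates lie there. The scale t is held fixed, so the twisted case still requires `tau_act`. -/
theorem scaledMetric_act (g : D.GR) (t : ℝ) (F : ℤ → Submodule ℂ (Cx V)) (u v : Cx V) :
    D.scaledMetric t (act (cxEquiv g) F) (cxEquiv g u) (cxEquiv g v) = D.scaledMetric t F u v := by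
  refine finsum_congr fun r ↦ ?_
  rw [proj_act, conjAlgEquiv_apply_apply, conjAlgEquiv_apply_apply, conj_cxEquiv,
    (D.complexify g).2.2 _ _ (proj_mem_WC F _ _ u) _ (conj_mem_WC (proj_mem_WC F _ _ v))]

theorem stdNorm_act (g : D.GR) (F : ℤ → Submodule ℂ (Cx V)) (X : Module.End ℂ (Cx V)) :
    D.stdNorm (act (cxEquiv g) F) (cxConj g X) = D.stdNorm F X := by
  unfold stdNorm
  rw [traceForm_conj (cxEquiv g) (H := D.hodgeMetric F) (H' := D.hodgeMetric (act (cxEquiv g) F))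
    (scaledMetric_act g 1 F)]

/-- There is no circularity: τ is measured in the untwisted metric, whose invariance is the case t =
1 of `scaledMetric_act`. -/
theorem tau_act (g : D.GR) (F : ℤ → Submodule ℂ (Cx V)) :
    D.tau (act (cxEquiv g) F) = D.tau F := by
  simp only [tau, epsilon_act, component_act, stdNorm_act]

theorem twistedMetric_act (g : D.GR) (F : ℤ → Submodule ℂ (Cx V)) (u v : Cx V) :
    D.twistedMetric (act (cxEquiv g) F) (cxEquiv g u) (cxEquiv g v) = D.twistedMetric F u v := by
  rw [twistedMetric, tau_act, scaledMetric_act, twistedMetric]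

/-! ### Tangent spaces and the differential of translation. -/

theorem Ad_inv_apply (a : D.GC) (X : D.lieC) : Ad a (Ad a⁻¹ X) = X := by
  refine Subtype.ext (LinearMap.ext fun v ↦ ?_)
  change (a : Cx V ≃ₗ[ℂ] Cx V) ((a : Cx V ≃ₗ[ℂ] Cx V).symm ((X : Module.End ℂ (Cx V))
    ((a : Cx V ≃ₗ[ℂ] Cx V) ((a : Cx V ≃ₗ[ℂ] Cx V).symm v)))) = _
  simp only [LinearEquiv.apply_symm_apply]

theorem Ad_bijective (a : D.GC) : Function.Bijective (Ad a) :=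
  Function.bijective_iff_has_inverse.2
    ⟨Ad a⁻¹, fun X ↦ by simpa using Ad_inv_apply a⁻¹ X, Ad_inv_apply a⟩

theorem coe_Ad (g : D.GR) (X : D.lieC) :
    (Ad (D.complexify g) X : Module.End ℂ (Cx V)) = cxConj g X := rfl

theorem Ad_mem_stabilizer (a : D.GC) (F : ℤ → Submodule ℂ (Cx V)) (X : D.lieC) :
    Ad a X ∈ D.stabilizer (act a F) ↔ X ∈ D.stabilizer F := by
  refine forall_congr' fun p ↦ ?_
  rw [(a : Cx V ≃ₗ[ℂ] Cx V).surjective.forall]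
  refine forall_congr' fun v ↦ ?_
  change _ → (a : Cx V ≃ₗ[ℂ] Cx V).conjAlgEquiv ℂ X _ ∈ _ ↔ _
  rw [conjAlgEquiv_apply_apply, act, mem_map_equiv_apply, mem_map_equiv_apply]

theorem pushforward_mk (a : D.GC) (F : ℤ → Submodule ℂ (Cx V)) (X : D.lieC) :
    pushforward a F (Submodule.Quotient.mk X) = Submodule.Quotient.mk (Ad a X) := rfl

/-- Ad(a) is bijective and matches the two stabilizers exactly. Conjugation plays no role here, so
this holds on all of G_ℂ. -/
theorem pushforward_bijective (a : D.GC) (F : ℤ → Submodule ℂ (Cx V)) :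
    Function.Bijective (pushforward a F) := by
  refine ⟨(injective_iff_map_eq_zero _).2 fun ξ hξ ↦ ?_, fun ξ ↦ ?_⟩
  · obtain ⟨X, rfl⟩ := Submodule.Quotient.mk_surjective _ ξ
    rw [pushforward_mk, Submodule.Quotient.mk_eq_zero, Ad_mem_stabilizer] at hξ
    exact (Submodule.Quotient.mk_eq_zero _).2 hξ
  · obtain ⟨Y, rfl⟩ := Submodule.Quotient.mk_surjective _ ξ
    obtain ⟨X, rfl⟩ := (Ad_bijective a).2 Y
    exact ⟨Submodule.Quotient.mk X, rfl⟩

/-- Unlike the stabilizer, 𝔤^{p,q} depends on conjugation through the I^{p,q}, so g is taken in G_ℝ.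
-/
theorem Ad_mem_g (g : D.GR) (F : ℤ → Submodule ℂ (Cx V)) (p q : ℤ) (X : D.lieC) :
    Ad (D.complexify g) X ∈ D.g (act (cxEquiv g) F) p q ↔ X ∈ D.g F p q := by
  refine forall_congr' fun r ↦ forall_congr' fun s ↦ ?_
  rw [(cxEquiv g).surjective.forall]
  refine forall_congr' fun v ↦ ?_
  rw [coe_Ad, conjAlgEquiv_apply_apply, apply_mem_I_act, apply_mem_I_act]

theorem qF_act (g : D.GR) (F : ℤ → Submodule ℂ (Cx V)) :
    D.qF (act (cxEquiv g) F) = (D.qF F).map (Ad (D.complexify g)) := by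
  have hg (p q : ℤ) :
      D.g (act (cxEquiv g) F) p q = (D.g F p q).map (Ad (D.complexify g)) := by
    ext Y
    obtain ⟨X, rfl⟩ := (Ad_bijective (D.complexify g)).2 Y
    rw [Ad_mem_g]
    exact ((Ad_bijective (D.complexify g)).1.mem_set_image).symm
  simp only [qF, Submodule.map_iSup, hg]

/-- Same principle as `map_dite_existsUnique_choose`, argued directly because the choice is made in
`D.lieC` and only then viewed as an endomorphism of V_ℂ. -/
theorem lift_act (g : D.GR) (F : ℤ → Submodule ℂ (Cx V)) (ξ : D.TangentSpace F) :
    D.lift (act (cxEquiv g) F) (pushforward (D.complexify g) F ξ) = cxConj g (D.lift F ξ) := by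
  have hAd := Ad_bijective (D.complexify g)
  have hiff (X : D.lieC) : (Ad (D.complexify g) X ∈ D.qF (act (cxEquiv g) F) ∧
      Submodule.Quotient.mk (Ad (D.complexify g) X) = pushforward (D.complexify g) F ξ) ↔
      X ∈ D.qF F ∧ Submodule.Quotient.mk X = ξ := by
    rw [qF_act, ← pushforward_mk, (pushforward_bijective (D.complexify g) F).1.eq_iff]
    exact and_congr_left' hAd.1.mem_set_image
  have key := hAd.existsUnique_iff (p := fun Y ↦ Y ∈ D.qF (act (cxEquiv g) F) ∧
    Submodule.Quotient.mk Y = pushforward (D.complexify g) F ξ)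
  simp only [hiff] at key
  unfold lift
  by_cases h : ∃! X : D.lieC, X ∈ D.qF F ∧ Submodule.Quotient.mk X = ξ
  · have h' := key.2 h
    rw [dif_pos h, dif_pos h', ← coe_Ad]
    exact congrArg _ (h'.unique h'.choose_spec.1 ((hiff _).2 h.choose_spec.1))
  · rw [dif_neg h, dif_neg (mt key.1 h), map_zero]

theorem hTau_act (g : D.GR) (F : ℤ → Submodule ℂ (Cx V)) (ξ ξ' : D.TangentSpace F) :
    D.hTau (act (cxEquiv g) F) (pushforward (D.complexify g) F ξ)
      (pushforward (D.complexify g) F ξ') = D.hTau F ξ ξ' := by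
  unfold hTau
  rw [lift_act, lift_act, traceForm_conj (cxEquiv g) (twistedMetric_act g F)]

/-! ### Stability of the classifying space. -/

/-- The automorphism of `Gr_w` induced by an element of `G_ℝ`. -/
def grEquiv (g : D.GR) (w : ℤ) : Gr D.W w ≃ₗ[ℝ] Gr D.W w :=
  Submodule.Quotient.equiv _ _ ((g : V ≃ₗ[ℝ] V).ofSubmodules (D.W w) (D.W w) (g.2.1 w)) (by
    ext ⟨x, hx⟩
    obtain ⟨⟨y, hy⟩, hyx⟩ :=
      ((g : V ≃ₗ[ℝ] V).ofSubmodules (D.W w) (D.W w) (g.2.1 w)).surjective ⟨x, hx⟩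
    rw [← hyx, mem_map_equiv_apply]
    change y ∈ D.W (w - 1) ↔ (g : V ≃ₗ[ℝ] V) y ∈ D.W (w - 1)
    conv_rhs => rw [← g.2.1 (w - 1)]
    exact (mem_map_equiv_apply _).symm)

theorem grEquiv_grMap (g : D.GR) {w : ℤ} {x : V} (hx : x ∈ D.W w) :
    grEquiv g w (grMap D.W w x) = grMap D.W w ((g : V ≃ₗ[ℝ] V) x) := by
  have hgx : (g : V ≃ₗ[ℝ] V) x ∈ D.W w := by
    rw [← g.2.1 w]
    exact Submodule.mem_map_of_mem hx
  rw [grMap_apply _ _ _ hx, grMap_apply _ _ _ hgx]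
  rfl

theorem grMap_surjOn (w : ℤ) (y : Gr D.W w) : ∃ x ∈ D.W w, grMap D.W w x = y := by
  obtain ⟨⟨x, hx⟩, rfl⟩ := Submodule.Quotient.mk_surjective _ y
  exact ⟨x, hx, grMap_apply _ _ _ hx⟩

theorem grEquiv_isometry (g : D.GR) (w : ℤ) (x y : Gr D.W w) :
    D.Q w (grEquiv g w x) (grEquiv g w y) = D.Q w x y := by
  obtain ⟨x, hx, rfl⟩ := grMap_surjOn w x
  obtain ⟨y, hy, rfl⟩ := grMap_surjOn w y
  rw [grEquiv_grMap g hx, grEquiv_grMap g hy, g.2.2 w x hx y hy]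

/-- Outside W_w the map `grMap` is an arbitrary linear extension, so compatibility with g is claimed
only on W_{w,ℂ} and checked on its real generators. -/
theorem grC_cxEquiv (g : D.GR) {w : ℤ} {x : Cx V} (hx : x ∈ WC D.W w) :
    grC D.W w (cxEquiv g x) = LinearEquiv.baseChange ℝ ℂ _ _ (grEquiv g w) (grC D.W w x) := by
  unfold WC at hx
  rw [Submodule.baseChange_eq_span] at hx
  induction hx using Submodule.span_induction with
  | zero => simp only [map_zero]
  | add a b _ _ ha hb => simp only [map_add, ha, hb]
  | smul c a _ ha => simp only [map_smul, ha]
  | mem a ha =>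
    obtain ⟨a, ha, rfl⟩ := ha
    exact congrArg (fun y ↦ (1 : ℂ) ⊗ₜ[ℝ] y) (grEquiv_grMap g ha).symm

theorem inducedFiltration_act (g : D.GR) (F : ℤ → Submodule ℂ (Cx V)) (w p : ℤ) :
    inducedFiltration D.W (act (cxEquiv g) F) w p = (inducedFiltration D.W F w p).map
      (LinearEquiv.baseChange ℝ ℂ _ _ (grEquiv g w)).toLinearMap := by
  simp only [inducedFiltration, act]
  -- Writing W_{w,ℂ} as its own image under g turns the intersection into the image of F^p ∩
  -- W_{w,ℂ}.
  conv_lhs => rw [← map_WC g w, ← map_equiv_inf]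
  ext y
  constructor
  · rintro ⟨_, ⟨x, hx, rfl⟩, rfl⟩
    exact ⟨_, ⟨x, hx, rfl⟩, (grC_cxEquiv g hx.2).symm⟩
  · rintro ⟨_, ⟨x, hx, rfl⟩, rfl⟩
    exact ⟨_, ⟨x, hx, rfl⟩, grC_cxEquiv g hx.2⟩

theorem act_mem_M (g : D.GR) {F : ℤ → Submodule ℂ (Cx V)} (hF : F ∈ D.M) :
    act (cxEquiv g) F ∈ D.M := by
  obtain ⟨hanti, ⟨a, ha⟩, ⟨b, hb⟩, h⟩ := hF
  refine ⟨fun p q hpq ↦ Submodule.map_mono (hanti hpq), ⟨a, ?_⟩, ⟨b, ?_⟩, fun w ↦ ?_⟩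
  · rw [act, ha, Submodule.map_top, LinearEquiv.range]
  · rw [act, hb, Submodule.map_bot]
  · rw [funext (inducedFiltration_act g F w)]
    exact (h w).map (grEquiv g w) (grEquiv_isometry g w)

end ClassifyingData

end MixedHodge

end

theorem mainTheorem11 {V : Type*} [AddCommGroup V] [Module ℝ V] [FiniteDimensional ℝ V]
    (D : MixedHodge.ClassifyingData V) (g : D.GR)
    (F : ℤ → Submodule ℂ (MixedHodge.Cx V)) (hF : F ∈ D.M) :
    MixedHodge.ClassifyingData.act (D.complexify g) F ∈ D.M ∧
    Function.Bijective (MixedHodge.ClassifyingData.pushforward (D.complexify g) F) ∧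
    ∀ ξ ξ' : D.TangentSpace F,
      D.hTau (MixedHodge.ClassifyingData.act (D.complexify g) F)
          (MixedHodge.ClassifyingData.pushforward (D.complexify g) F ξ)
          (MixedHodge.ClassifyingData.pushforward (D.complexify g) F ξ') =
        D.hTau F ξ ξ' :=
  ⟨MixedHodge.ClassifyingData.act_mem_M g hF,
    MixedHodge.ClassifyingData.pushforward_bijective (D.complexify g) F,
    MixedHodge.ClassifyingData.hTau_act g F⟩
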